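/- Let $F$ be a real function of a real variable, and let $\hat x=\hat x(x,\delta)\ge 0$ denote a solution of the transcendental equation $$e^{\hat x}(\hat x-1)=\delta\,e^{x}(x-1),\qquad x\ge 1,\quad \delta\le 1 .$$ Define functions $F_n$ by $$F_0(y)=-y^2\,\frac{d}{dy}F(1/y),\qquad F_n(y)=\Big[n(y+1)+y^2\frac{d}{dy}\Big]F_{n-1}(y)\quad(n\ge 1).$$ Then $F(\hat x(x,\delta))$ is given by the functional series $$F(\hat x)=F(x)-\sum_{n=1}^{\infty}\frac{(1-\delta)^n}{n!}\Big(1-\frac1x\Big)^nF_{n-1}\Big(\frac1x\Big)\qquad(*)$$ in the following sense, for every $x\ge1$. 1. If $F$ is $N$ times continuously differentiable near $x$ ($N\ge 0$), then $F(\hat x)=F(x)-\sum_{n=1}^{N}\frac{(1-\delta)^n}{n!}(1-\frac1x)^nF_{n-1}(\frac1x)+o\big((1-\delta)^N\big)$ as $\delta\to1$, $\delta\le 1$. 2. If $F$ is real-analytic at $x$, there is $r>0$ such that for $1-r<\delta\le1$ the series converges and $(*)$ holds. 3. For every $\delta\le1$ for which a solution $\hat x\ge0$ exists: if $F$ is real-analytic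 at every point of $(\hat x,x]$ and continuous on $[\hat x,x]$, then $(*)$ holds whenever the series in $(*)$ converges. 4. If $F$ is real-analytic at every point of $(1,x]$ and $\big|(1-\frac1x)^nF_{n-1}(\frac1x)\big|<n!$ for all sufficiently large $n$, then for every $0<\delta\le1$ the series converges and $(*)$ holds. -/

import Mathlib

/-- `xh` is a solution, in the range `xh ≥ 0`, of the transcendental equation
`e ^ xh * (xh - 1) = δ * e ^ x * (x - 1)`. -/
def IsTranscSol (x δ xh : ℝ) : Prop :=
  0 ≤ xh ∧ Real.exp xh * (xh - 1) = δ * Real.exp x * (x - 1)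

/-- The functions `F_n`: `F_0(y) = -y² d(F(1/y))/dy` and
`F_n(y) = [n (y + 1) + y² d/dy] F_{n-1}(y)` for `n ≥ 1`. -/
noncomputable def FSeq (F : ℝ → ℝ) : ℕ → ℝ → ℝ
  | 0 => fun y => -y ^ 2 * deriv (fun t => F (1 / t)) y
  | n + 1 => fun y =>
      ((n + 1 : ℕ) : ℝ) * (y + 1) * FSeq F n y + y ^ 2 * deriv (FSeq F n) y

/-- The term of index `n` (used for `n ≥ 1`) of the series,
`(1 - δ)^n / n! * (1 - 1/x)^n * F_{n-1}(1/x)`. -/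
noncomputable def seriesTerm (F : ℝ → ℝ) (x δ : ℝ) (n : ℕ) : ℝ :=
  (1 - δ) ^ n / (n.factorial : ℝ) * (1 - 1 / x) ^ n * FSeq F (n - 1) (1 / x)

open Filter Topology Set

/-! The series is the Taylor series at `δ = 1` of `δ ↦ F (x̂ δ)`. Since `t ↦ e^t (t - 1)` has
derivative `t e^t`, it is invertible on `[0, ∞)`, analytically so at `t > 0`. Extended to a
bijection of ℝ, it has a total inverse, and `transComp` is a function of every real `δ`. With `c =
e^x (x - 1)`, `d/dδ = c / (t e^t) · d/dt`; iterating gives the derivatives in terms of `F_n`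
(`iteratedDeriv_transComp`), and at `t = x` the factor `c / (t e^t)` is `1 - 1/x`. Claim 1 is then
Taylor–Peano, and claim 2 is analyticity of a composition. Claim 3 combines the identity theorem
with Abel's theorem on the segment from `1` to `δ`. Claim 4 reduces to claim 3 by geometric
domination. -/

/-! ### The transcendental map and its inverse. -/

/-- A strictly increasing extension of `t ↦ e ^ t * (t - 1)` from `[0, ∞)` to the real line. -/
noncomputable def transMap (t : ℝ) : ℝ :=
  Real.exp (max t 0) * (max t 0 - 1) + min t 0

theorem transMap_of_nonneg {t : ℝ} (ht : 0 ≤ t) : transMap t = Real.exp t * (t - 1) := by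
  simp [transMap, ht]

theorem transMap_of_nonpos {t : ℝ} (ht : t ≤ 0) : transMap t = t - 1 := by
  simp [transMap, ht]; ring

theorem continuous_transMap : Continuous transMap := by
  unfold transMap; fun_prop

theorem hasDerivAt_exp_mul_sub_one (t : ℝ) :
    HasDerivAt (fun s : ℝ => Real.exp s * (s - 1)) (t * Real.exp t) t := by
  have h := (Real.hasDerivAt_exp t).mul ((hasDerivAt_id t).sub_const 1)
  refine h.congr_deriv ?_
  simp only [id]
  ring

theorem strictMonoOn_exp_mul_sub_one :
    StrictMonoOn (fun s : ℝ => Real.exp s * (s - 1)) (Ici 0) := by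
  refine strictMonoOn_of_deriv_pos (convex_Ici 0) (by fun_prop) fun t ht => ?_
  rw [interior_Ici] at ht
  rw [(hasDerivAt_exp_mul_sub_one t).deriv]
  exact mul_pos ht (Real.exp_pos t)

theorem strictMono_transMap : StrictMono transMap := by
  intro a b hab
  rcases le_or_gt b 0 with hb | hb
  · rw [transMap_of_nonpos hb, transMap_of_nonpos (hab.le.trans hb)]
    linarith
  · have h := strictMonoOn_exp_mul_sub_one (show max a 0 ∈ Ici (0 : ℝ) from le_max_right a 0)
      (show max b 0 ∈ Ici (0 : ℝ) from le_max_right b 0)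
      (by rw [max_eq_left hb.le]; exact max_lt hab hb)
    exact add_lt_add_of_lt_of_le h (min_le_min_right 0 hab.le)

theorem surjective_transMap : Function.Surjective transMap := by
  refine continuous_transMap.surjective ?_ ?_
  · refine tendsto_atTop_mono' _ ?_ (tendsto_atTop_add_const_right atTop (-1 : ℝ) tendsto_id)
    filter_upwards [eventually_ge_atTop 1] with t ht
    rw [transMap_of_nonneg (by linarith)]
    have := Real.one_le_exp (show 0 ≤ t by linarith)
    simp only [id]
    nlinarith
  · refine (tendsto_atBot_add_const_right atBot (-1 : ℝ) tendsto_id).congr' ?_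
    filter_upwards [eventually_le_atBot 0] with t ht
    rw [transMap_of_nonpos ht]
    simp only [id]
    ring

/-- `transMap` as an order isomorphism. -/
noncomputable def transIso : ℝ ≃o ℝ :=
  strictMono_transMap.orderIsoOfSurjective _ surjective_transMap

theorem transIso_apply (t : ℝ) : transIso t = transMap t := rfl

theorem hasDerivAt_transMap {t : ℝ} (ht : 0 < t) : HasDerivAt transMap (t * Real.exp t) t := by
  refine (hasDerivAt_exp_mul_sub_one t).congr_of_eventuallyEq ?_
  filter_upwards [lt_mem_nhds ht] with s hs
  exact transMap_of_nonneg hs.le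

theorem contDiffAt_transIso_symm {w : ℝ} (hw : 0 < transIso.symm w) (n : WithTop ℕ∞) :
    ContDiffAt ℝ n transIso.symm w := by
  refine transIso.toHomeomorph.toOpenPartialHomeomorph.contDiffAt_symm_deriv
    (f₀' := transIso.symm w * Real.exp (transIso.symm w)) (a := w) (by positivity) (by simp)
    (hasDerivAt_transMap hw) ?_
  have h : ContDiffAt ℝ n (fun s : ℝ => Real.exp s * (s - 1)) (transIso.symm w) := by fun_prop
  refine h.congr_of_eventuallyEq ?_
  filter_upwards [lt_mem_nhds hw] with s hs
  exact transMap_of_nonneg hs.le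

theorem hasDerivAt_transIso_symm {w : ℝ} (hw : 0 < transIso.symm w) :
    HasDerivAt transIso.symm (transIso.symm w * Real.exp (transIso.symm w))⁻¹ w := by
  refine HasDerivAt.of_local_left_inverse transIso.symm.continuous.continuousAt
    (hasDerivAt_transMap hw) (by positivity) ?_
  exact Eventually.of_forall fun y => transIso.apply_symm_apply y

/-! ### Derivatives in `δ` and Taylor coefficients. -/

/-- `F` at the solution of the transcendental equation, as a function of `δ`. -/
noncomputable def transComp (F : ℝ → ℝ) (x δ : ℝ) : ℝ :=
  F (transIso.symm (δ * (Real.exp x * (x - 1))))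

theorem IsTranscSol.symm_eq {x δ xh : ℝ} (h : IsTranscSol x δ xh) :
    transIso.symm (δ * (Real.exp x * (x - 1))) = xh := by
  rw [OrderIso.symm_apply_eq, transIso_apply, transMap_of_nonneg h.1, h.2]
  ring

theorem symm_at_one {x : ℝ} (hx : 0 ≤ x) :
    transIso.symm (1 * (Real.exp x * (x - 1))) = x :=
  IsTranscSol.symm_eq ⟨hx, by ring⟩

/-- `F_n` contains derivatives of `F` up to order `n + 1`. -/
theorem contDiffAt_FSeq {F : ℝ → ℝ} {y : ℝ} (hy : y ≠ 0) (n k : ℕ)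
    (hF : ContDiffAt ℝ (n + 1 + k : ℕ) F (1 / y)) : ContDiffAt ℝ k (FSeq F n) y := by
  induction n generalizing k with
  | zero =>
    have h1 : ContDiffAt ℝ (0 + 1 + k : ℕ) (fun t : ℝ => F (1 / t)) y :=
      ContDiffAt.comp y (f := fun t : ℝ => 1 / t) hF (contDiffAt_const.div contDiffAt_id hy)
    have h2 : ContDiffAt ℝ k (deriv fun t : ℝ => F (1 / t)) y :=
      h1.derivWithin (by norm_cast; omega)
    exact (contDiffAt_id.pow 2).neg.mul h2
  | succ n ih =>
    have h0 : ContDiffAt ℝ (k + 1 : ℕ) (FSeq F n) y :=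
      ih (k + 1) (by convert hF using 2; omega)
    have h1 : ContDiffAt ℝ k (deriv (FSeq F n)) y := h0.derivWithin (by norm_cast)
    have h2 : ContDiffAt ℝ k (FSeq F n) y := ih k (hF.of_le (by norm_cast; omega))
    exact ((contDiffAt_const.mul (contDiffAt_id.add contDiffAt_const)).mul h2).add
      ((contDiffAt_id.pow 2).mul h1)

theorem contDiffAt_transComp {F : ℝ → ℝ} {x δ : ℝ} {n : WithTop ℕ∞}
    (hpos : 0 < transIso.symm (δ * (Real.exp x * (x - 1))))
    (hF : ContDiffAt ℝ n F (transIso.symm (δ * (Real.exp x * (x - 1))))) :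
    ContDiffAt ℝ n (transComp F x) δ := by
  have h1 : ContDiffAt ℝ n (fun δ : ℝ => δ * (Real.exp x * (x - 1))) δ := by fun_prop
  exact ContDiffAt.comp δ (g := F) hF
    (ContDiffAt.comp δ (g := transIso.symm) (contDiffAt_transIso_symm hpos n) h1)

theorem continuous_symm_mul (x : ℝ) :
    Continuous fun δ : ℝ => transIso.symm (δ * (Real.exp x * (x - 1))) :=
  transIso.symm.continuous.comp (by fun_prop)

theorem hasDerivAt_symm_mul {c δ : ℝ} (hpos : 0 < transIso.symm (δ * c)) :
    HasDerivAt (fun δ : ℝ => transIso.symm (δ * c))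
      ((transIso.symm (δ * c) * Real.exp (transIso.symm (δ * c)))⁻¹ * c) δ :=
  HasDerivAt.comp δ (h₂ := transIso.symm) (h := fun δ : ℝ => δ * c)
    (hasDerivAt_transIso_symm hpos) (hasDerivAt_mul_const c)

/-- With `y = 1/t`, differentiating `(t e^t)^(-(n+1))` in `t` brings out `-(n+1)(y+1)`, and `d/dt =
-y² d/dy` on `F_n(1/t)`; together these are minus the operator defining `F_{n+1}`. -/
theorem iteratedDeriv_transComp {F : ℝ → ℝ} {x : ℝ} (n : ℕ) {δ t : ℝ}
    (ht : transIso.symm (δ * (Real.exp x * (x - 1))) = t) (hpos : 0 < t)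
    (hF : ContDiffAt ℝ (n + 1 : ℕ) F t) :
    iteratedDeriv (n + 1) (transComp F x) δ =
      (-1) ^ n * (Real.exp x * (x - 1)) ^ (n + 1) / (t * Real.exp t) ^ (n + 1) *
        FSeq F n (1 / t) := by
  set c := Real.exp x * (x - 1) with hc
  have hX : HasDerivAt (fun δ : ℝ => transIso.symm (δ * c)) ((t * Real.exp t)⁻¹ * c) δ := by
    subst ht
    exact hasDerivAt_symm_mul hpos
  have het : Real.exp t ≠ 0 := (Real.exp_pos t).ne'
  induction n generalizing δ t with
  | zero =>
    have hFd : HasDerivAt F (deriv F t) t :=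
      (hF.differentiableAt (by norm_num)).hasDerivAt
    have hinv : HasDerivAt (fun s : ℝ => 1 / s) (-t ^ 2) (1 / t) := by
      have := hasDerivAt_inv (x := 1 / t) (by positivity)
      simpa using this
    have hcomp : HasDerivAt (fun s : ℝ => F (1 / s)) (deriv F t * (-t ^ 2)) (1 / t) :=
      HasDerivAt.comp (1 / t) (h₂ := F) (by simpa using hFd) hinv
    have hd : HasDerivAt (transComp F x) (deriv F t * ((t * Real.exp t)⁻¹ * c)) δ :=
      HasDerivAt.comp δ (h₂ := F) (by rw [ht]; exact hFd) hX
    rw [zero_add, iteratedDeriv_one, hd.deriv]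
    simp only [FSeq, hcomp.deriv]
    field_simp
  | succ n ih =>
    -- The formula must hold near `δ` to be differentiated, hence the induction over all `δ` and
    -- `t`.
    have hev : ∀ᶠ d in 𝓝 δ, iteratedDeriv (n + 1) (transComp F x) d =
        (-1) ^ n * c ^ (n + 1) /
          (transIso.symm (d * c) * Real.exp (transIso.symm (d * c))) ^ (n + 1) *
        FSeq F n (1 / transIso.symm (d * c)) := by
      have hcont : Tendsto (fun d : ℝ => transIso.symm (d * c)) (𝓝 δ) (𝓝 t) := by
        rw [← ht]; exact (continuous_symm_mul x).tendsto δ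
      have hF' : ∀ᶠ s in 𝓝 t, ContDiffAt ℝ (n + 1 : ℕ) F s :=
        (hF.of_le (by norm_cast; omega)).eventually (by simp)
      filter_upwards [hcont.eventually hF', hcont.eventually (lt_mem_nhds hpos)] with d h1 h2
      exact ih h2 h1 rfl (hasDerivAt_symm_mul h2) (Real.exp_pos _).ne'
    have hS : HasDerivAt (FSeq F n) (deriv (FSeq F n) (1 / t)) (1 / t) := by
      refine ((contDiffAt_FSeq (k := 1) (by positivity) n ?_).differentiableAt
        (by norm_num)).hasDerivAt
      simpa using hF
    have hinv : HasDerivAt (fun s : ℝ => 1 / s) (-(t ^ 2)⁻¹) t := by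
      simpa using hasDerivAt_inv hpos.ne'
    have hS' : HasDerivAt (fun s : ℝ => FSeq F n (1 / s))
        (deriv (FSeq F n) (1 / t) * (-(t ^ 2)⁻¹)) t :=
      HasDerivAt.comp t (h₂ := FSeq F n) hS hinv
    have hden : HasDerivAt (fun s : ℝ => (s * Real.exp s) ^ (n + 1))
        ((n + 1 : ℕ) * (t * Real.exp t) ^ n * (1 * Real.exp t + t * Real.exp t)) t := by
      simpa using ((hasDerivAt_id' t).fun_mul (Real.hasDerivAt_exp t)).fun_pow (n + 1)
    have hq := ((hasDerivAt_const t ((-1) ^ n * c ^ (n + 1))).fun_div hden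
      (by positivity)).fun_mul hS'
    have hd := HasDerivAt.comp δ (h := fun δ : ℝ => transIso.symm (δ * c)) (by rw [ht]; exact hq) hX
    rw [iteratedDeriv_succ, EventuallyEq.deriv_eq hev]
    refine (HasDerivAt.deriv hd).trans ?_
    simp only [FSeq]
    field_simp
    ring

theorem taylor_coeff_transComp {F : ℝ → ℝ} {x : ℝ} (hx : 1 ≤ x) (δ : ℝ) (n : ℕ)
    (hF : ContDiffAt ℝ (n + 1 : ℕ) F x) :
    iteratedDeriv (n + 1) (transComp F x) 1 / ((n + 1).factorial : ℝ) * (δ - 1) ^ (n + 1) =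
      -seriesTerm F x δ (n + 1) := by
  have hx0 : 0 < x := by linarith
  have hex : Real.exp x ≠ 0 := (Real.exp_pos x).ne'
  rw [iteratedDeriv_transComp n (symm_at_one hx0.le) hx0 hF, seriesTerm, Nat.add_sub_cancel]
  have h1 : (1 : ℝ) - 1 / x = (x - 1) / x := by field_simp
  have h2 : (1 - δ) ^ (n + 1) = -((-1) ^ n * (δ - 1) ^ (n + 1)) := by
    rw [← neg_sub δ 1, neg_pow]; ring
  rw [h1, h2, mul_pow, mul_pow, div_pow]
  field_simp

theorem transComp_one {F : ℝ → ℝ} {x : ℝ} (hx : 1 ≤ x) : transComp F x 1 = F x := by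
  rw [transComp, symm_at_one (by linarith)]

theorem taylor_sum_transComp {F : ℝ → ℝ} {x : ℝ} (hx : 1 ≤ x) (δ : ℝ) (N : ℕ)
    (hF : ContDiffAt ℝ N F x) :
    ∑ k ∈ Finset.range (N + 1),
        iteratedDeriv k (transComp F x) 1 / (k.factorial : ℝ) * (δ - 1) ^ k =
      F x - ∑ n ∈ Finset.Icc 1 N, seriesTerm F x δ n := by
  induction N with
  | zero => simp [transComp_one hx]
  | succ N ih =>
    rw [Finset.sum_range_succ, ih (hF.of_le (by norm_cast; omega)),
      taylor_coeff_transComp hx δ N hF, Finset.sum_Icc_succ_top (by omega)]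
    ring

/-! ### Local expansions at `δ = 1`. -/

theorem isLittleO_transComp {F : ℝ → ℝ} {x : ℝ} (hx : 1 ≤ x) (N : ℕ) (hF : ContDiffAt ℝ N F x) :
    (fun δ => transComp F x δ - (F x - ∑ n ∈ Finset.Icc 1 N, seriesTerm F x δ n))
      =o[𝓝 1] fun δ => (1 - δ) ^ N := by
  have hC : ContDiffAt ℝ N (transComp F x) 1 :=
    contDiffAt_transComp (by rw [symm_at_one] <;> linarith)
      (by rw [symm_at_one (by linarith)]; exact hF)
  obtain ⟨ε, hε, hball⟩ := Metric.eventually_nhds_iff_ball.1 (hC.eventually (by simp))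
  have h1 : (1 : ℝ) ∈ Metric.ball 1 ε := Metric.mem_ball_self hε
  have hT := taylor_isLittleO (convex_ball (1 : ℝ) ε) h1
    (fun y hy => (hball y hy).contDiffWithinAt)
  rw [Metric.isOpen_ball.nhdsWithin_eq h1] at hT
  refine (hT.congr_left fun δ => ?_).trans_isBigO (Asymptotics.IsBigO.of_bound' (Eventually.of_forall fun δ => ?_))
  · rw [taylor_within_apply, ← taylor_sum_transComp hx δ N hF]
    congr 1
    refine Finset.sum_congr rfl fun k hk => ?_
    rw [iteratedDerivWithin_eq_iteratedDeriv Metric.isOpen_ball.uniqueDiffOn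
      (hC.of_le (by norm_cast; exact Nat.lt_succ_iff.1 (Finset.mem_range.1 hk))) h1, smul_eq_mul]
    ring
  · rw [← neg_sub 1 δ, neg_pow, norm_mul, norm_pow, norm_neg, norm_one, one_pow, one_mul]

theorem eventually_hasSum_transComp {F : ℝ → ℝ} {x : ℝ} (hx : 1 ≤ x) (hF : AnalyticAt ℝ F x) :
    ∀ᶠ h in 𝓝 (0 : ℝ), HasSum
      (fun n : ℕ => iteratedDeriv n (transComp F x) 1 / (n.factorial : ℝ) * h ^ n)
      (transComp F x (1 + h)) := by
  -- The exponent `⊤` in `WithTop ℕ∞` means analytic.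
  have hA : AnalyticAt ℝ (transComp F x) 1 :=
    (contDiffAt_transComp (n := ⊤) (by rw [symm_at_one] <;> linarith)
      (by rw [symm_at_one (by linarith)]; exact hF.contDiffAt)).analyticAt
  filter_upwards [hA.hasFPowerSeriesAt.eventually_hasSum] with h hh
  simpa [FormalMultilinearSeries.ofScalars_apply_eq, mul_comm] using hh

/-! ### Convergence up to the endpoint. -/

/-- Abel summation of a power series at an endpoint of an interval of analyticity. -/
theorem eq_of_tendsto_powerSeries {f : ℝ → ℝ} {a : ℕ → ℝ} {l : ℝ}
    (hf : AnalyticOnNhd ℝ f (Ico 0 1)) (hcont : ContinuousWithinAt f (Icc 0 1) 1)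
    (hsum : ∀ᶠ z in 𝓝 (0 : ℝ), HasSum (fun n => a n * z ^ n) (f z))
    (hl : Tendsto (fun N => ∑ n ∈ Finset.range N, a n) atTop (𝓝 l)) : f 1 = l := by
  have habel := Real.tendsto_tsum_powerSeries_nhdsWithin_lt hl
  have ha : Tendsto a atTop (𝓝 0) := by
    have h := (hl.comp (tendsto_add_atTop_nat 1)).sub hl
    simpa [Finset.sum_range_succ] using h
  let p := FormalMultilinearSeries.ofScalars ℝ a
  -- Coefficients tending to `0` are bounded, so the radius is at least `1`.
  have hrad : (1 : ENNReal) ≤ p.radius := by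
    refine p.le_radius_of_tendsto (r := 1) (l := 0) ?_
    simpa [p, FormalMultilinearSeries.ofScalars_norm] using ha.norm
  have hp : p.sum = fun z => ∑' n, a n * z ^ n := by
    ext z
    simp [p, FormalMultilinearSeries.sum, mul_comm]
  have hpA : AnalyticOnNhd ℝ p.sum (Ico 0 1) := by
    intro z hz
    refine (p.hasFPowerSeriesOnBall (zero_lt_one.trans_le hrad)).analyticAt_of_mem ?_
    refine Metric.eball_subset_eball hrad ?_
    rw [← ENNReal.ofReal_one, Metric.eball_ofReal, mem_ball_zero_iff, Real.norm_eq_abs,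
      abs_of_nonneg hz.1]
    exact hz.2
  have heq : EqOn f p.sum (Ico 0 1) := by
    refine hf.eqOn_of_preconnected_of_eventuallyEq hpA isPreconnected_Ico (z₀ := 0) (by simp) ?_
    filter_upwards [hsum] with z hz
    rw [hp]
    exact hz.tsum_eq.symm
  have hlt : Tendsto f (𝓝[<] 1) (𝓝 (f 1)) := by
    refine hcont.mono_left ?_
    rw [← nhdsWithin_Ico_eq_nhdsLT (zero_lt_one' ℝ)]
    exact nhdsWithin_mono _ Ico_subset_Icc_self
  refine tendsto_nhds_unique hlt (habel.congr' ?_)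
  filter_upwards [Ico_mem_nhdsLT (zero_lt_one' ℝ)] with z hz
  rw [heq hz, hp]

theorem eq_sub_of_tendsto_seriesTerm {F : ℝ → ℝ} {x δ xh s : ℝ} (hx : 1 ≤ x) (hδ : δ ≤ 1)
    (hs : IsTranscSol x δ xh) (hA : AnalyticOnNhd ℝ F (Ioc xh x))
    (hC : ContinuousOn F (Icc xh x))
    (hT : Tendsto (fun N : ℕ => ∑ n ∈ Finset.Icc 1 N, seriesTerm F x δ n) atTop (𝓝 s)) :
    F xh = F x - s := by
  have hsymm := hs.symm_eq
  have hc0 : 0 ≤ Real.exp x * (x - 1) := mul_nonneg (Real.exp_pos x).le (by linarith)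
  rcases eq_or_lt_of_le (show xh ≤ x by
    have h := transIso.symm.monotone (mul_le_mul_of_nonneg_right hδ hc0)
    rwa [hsymm, symm_at_one (by linarith)] at h) with hxx | hlt
  · have hzero : ∀ n, 1 ≤ n → seriesTerm F x δ n = 0 := by
      intro n hn
      have h2 := hs.2
      rw [hxx] at h2
      have h3 : (1 - δ) * (x - 1) = 0 := by
        have : Real.exp x * ((1 - δ) * (x - 1)) = 0 := by linarith
        simpa [(Real.exp_pos x).ne'] using this
      have h4 : (1 - δ) * (1 - 1 / x) = 0 := by
        have hx0 : x ≠ 0 := by linarith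
        rw [show (1 - δ) * (1 - 1 / x) = (1 - δ) * (x - 1) / x by field_simp, h3, zero_div]
      rw [seriesTerm, div_mul_eq_mul_div, ← mul_pow, h4, zero_pow (by omega)]
      simp
    have : s = 0 := by
      refine tendsto_nhds_unique hT (tendsto_const_nhds.congr fun N => ?_)
      exact (Finset.sum_eq_zero fun n hn => hzero n (Finset.mem_Icc.1 hn).1).symm
    rw [hxx, this, sub_zero]
  · set c := Real.exp x * (x - 1) with hc
    have hFx : AnalyticAt ℝ F x := hA x ⟨hlt, le_rfl⟩
    have hone : transIso.symm (1 * c) = x := symm_at_one (by linarith)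
    have hδc : δ * c < 1 * c := by
      rw [← transIso.symm.lt_iff_lt, hsymm, hone]; exact hlt
    have hcpos : 0 < c := by
      refine hc0.lt_of_ne fun h => ?_
      rw [← h] at hδc
      simp at hδc
    have hδ1 : δ < 1 := lt_of_mul_lt_mul_right hδc hc0
    have hmem : ∀ z ∈ Icc (0 : ℝ) 1, transIso.symm ((1 + z * (δ - 1)) * c) ∈ Icc xh x := by
      intro z hz
      rw [← hsymm, ← hone]
      constructor <;>
      · rw [transIso.symm.le_iff_le]
        refine mul_le_mul_of_nonneg_right ?_ hc0
        nlinarith [hz.1, hz.2]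
    -- The segment is parametrized by `z ∈ [0, 1]`, from `x` at `z = 0` to `xh` at `z = 1`. For `z <
    -- 1` the point exceeds `xh ≥ 0`, so the zero of `t e^t` at `t = 0` can be met only at `z = 1`,
    -- where continuity suffices.
    have key : (fun z : ℝ => transComp F x (1 + z * (δ - 1))) 1 = F x - s := by
      refine eq_of_tendsto_powerSeries (f := fun z : ℝ => transComp F x (1 + z * (δ - 1)))
        (a := fun n => iteratedDeriv n (transComp F x) 1 / (n.factorial : ℝ) * (δ - 1) ^ n)
        ?_ ?_ ?_ ?_
      · intro z hz
        have hz' : transIso.symm ((1 + z * (δ - 1)) * c) ∈ Ioc xh x := by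
          refine ⟨?_, (hmem z ⟨hz.1, hz.2.le⟩).2⟩
          rw [← hsymm, transIso.symm.lt_iff_lt]
          refine mul_lt_mul_of_pos_right ?_ hcpos
          nlinarith [hz.1, hz.2]
        have h1 : AnalyticAt ℝ (transComp F x) (1 + z * (δ - 1)) :=
          (contDiffAt_transComp (n := ⊤) (hs.1.trans_lt hz'.1) (hA _ hz').contDiffAt).analyticAt
        exact h1.fun_comp (f := fun z : ℝ => 1 + z * (δ - 1)) (by fun_prop)
      · have hmaps : MapsTo (fun z : ℝ => transIso.symm ((1 + z * (δ - 1)) * c))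
          (Icc 0 1) (Icc xh x) := hmem
        have hcs : Continuous fun z : ℝ => transIso.symm ((1 + z * (δ - 1)) * c) :=
          (continuous_symm_mul x).comp (by fun_prop)
        exact (hC.comp hcs.continuousOn hmaps) 1 (by simp)
      · have hz : Tendsto (fun z : ℝ => z * (δ - 1)) (𝓝 0) (𝓝 0) := by
          have h : Continuous fun z : ℝ => z * (δ - 1) := by fun_prop
          simpa using h.tendsto 0
        filter_upwards [hz.eventually (eventually_hasSum_transComp hx hFx)] with z h
        refine h.congr_fun ?_
        intro n
        rw [mul_pow]; ring
      · rw [← tendsto_add_atTop_iff_nat 1]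
        exact (hT.const_sub (F x)).congr fun N =>
          (taylor_sum_transComp hx δ N hFx.contDiffAt).symm
    rw [← key]
    simp only [transComp, one_mul, add_sub_cancel]
    rw [hsymm]

theorem exists_radius_hasSum_seriesTerm {F : ℝ → ℝ} {x : ℝ} (hx : 1 ≤ x)
    (hF : AnalyticAt ℝ F x) :
    ∃ r : ℝ, 0 < r ∧ ∀ δ xh : ℝ, 1 - r < δ → δ ≤ 1 → IsTranscSol x δ xh →
      Summable (fun n : ℕ => seriesTerm F x δ (n + 1)) ∧
      F xh = F x - ∑' n : ℕ, seriesTerm F x δ (n + 1) := by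
  obtain ⟨r, hr, hball⟩ := Metric.eventually_nhds_iff.1 (eventually_hasSum_transComp hx hF)
  refine ⟨r, hr, fun δ xh h1 h2 hs => ?_⟩
  have h := hball (y := δ - 1) (by
    rw [dist_zero_right, Real.norm_eq_abs, abs_lt]; constructor <;> linarith)
  -- Splits off the constant term `F x`.
  rw [← hasSum_nat_add_iff' 1] at h
  simp only [taylor_coeff_transComp hx δ _ hF.contDiffAt] at h
  have h' := h.neg
  simp only [neg_neg] at h'
  refine ⟨h'.summable, ?_⟩
  rw [h'.tsum_eq]
  simp [transComp_one hx]
  rw [transComp, hs.symm_eq]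

/-! ### The growth criterion and the final assembly. -/

theorem summable_seriesTerm {F : ℝ → ℝ} {x δ : ℝ} (h0 : 0 < δ) (h1 : δ ≤ 1)
    (hgrowth : ∃ n₀ : ℕ, ∀ n : ℕ, n₀ ≤ n → 1 ≤ n →
      |(1 - 1 / x) ^ n * FSeq F (n - 1) (1 / x)| < (n.factorial : ℝ)) :
    Summable (fun n : ℕ => seriesTerm F x δ (n + 1)) := by
  obtain ⟨n₀, hn₀⟩ := hgrowth
  rw [← summable_nat_add_iff n₀]
  have hg : Summable fun n : ℕ => (1 - δ) ^ n :=
    summable_geometric_of_lt_one (by linarith) (by linarith)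
  refine Summable.of_norm_bounded ((summable_nat_add_iff (n₀ + 1)).2 hg) fun n => ?_
  have h := hn₀ (n + n₀ + 1) (by omega) (by omega)
  have hfac : (0 : ℝ) < ((n + n₀ + 1).factorial : ℝ) := by positivity
  have hpow : 0 ≤ (1 - δ) ^ (n + n₀ + 1) := pow_nonneg (by linarith) _
  rw [seriesTerm, mul_assoc, norm_mul, Real.norm_eq_abs, Real.norm_eq_abs, abs_div,
    abs_of_nonneg hpow, abs_of_pos hfac, div_mul_eq_mul_div, div_le_iff₀ hfac]
  exact mul_le_mul_of_nonneg_left h.le hpow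

theorem one_le_of_isTranscSol {x δ xh : ℝ} (hx : 1 ≤ x) (h0 : 0 < δ)
    (hs : IsTranscSol x δ xh) : 1 ≤ xh := by
  have h : 0 ≤ Real.exp xh * (xh - 1) := by
    rw [hs.2]
    exact mul_nonneg (by positivity) (by linarith)
  linarith [nonneg_of_mul_nonneg_right h (Real.exp_pos xh)]

theorem eq_one_of_isTranscSol_one {x δ : ℝ} (h0 : 0 < δ) (hs : IsTranscSol x δ 1) : x = 1 := by
  have h := hs.2
  rw [sub_self, mul_zero, eq_comm, mul_eq_zero] at h
  rcases h with h | h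
  · exact absurd h (by positivity)
  · linarith


theorem theorem7 (F : ℝ → ℝ) (x : ℝ) (hx : 1 ≤ x) :
    -- `F` of class `C^N` near `x`: the partial sums are the expansion of `F(xh)` as `δ → 1`
    (∀ (N : ℕ) (xh : ℝ → ℝ), ContDiffAt ℝ N F x →
      (∀ᶠ δ in nhdsWithin (1 : ℝ) (Set.Iic 1), IsTranscSol x δ (xh δ)) →
      Asymptotics.IsLittleO (nhdsWithin (1 : ℝ) (Set.Iic 1))
        (fun δ => F (xh δ) - (F x - ∑ n ∈ Finset.Icc 1 N, seriesTerm F x δ n))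
        (fun δ => (1 - δ) ^ N)) ∧
    -- `F` analytic at `x`: the series converges to the right value for all `δ ≤ 1` close to `1`
    (AnalyticAt ℝ F x →
      ∃ r : ℝ, 0 < r ∧ ∀ δ xh : ℝ, 1 - r < δ → δ ≤ 1 → IsTranscSol x δ xh →
        Summable (fun n : ℕ => seriesTerm F x δ (n + 1)) ∧
        F xh = F x - ∑' n : ℕ, seriesTerm F x δ (n + 1)) ∧
    -- `F` analytic between `xh` and `x`: the formula holds whenever the series converges
    (∀ δ xh : ℝ, δ ≤ 1 → IsTranscSol x δ xh →
      AnalyticOnNhd ℝ F (Set.Ioc xh x) → ContinuousOn F (Set.Icc xh x) →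
      ∀ s : ℝ, Filter.Tendsto (fun N : ℕ => ∑ n ∈ Finset.Icc 1 N, seriesTerm F x δ n)
          Filter.atTop (nhds s) →
        F xh = F x - s) ∧
    -- `F` analytic on `(1, x]` with the growth condition: the formula holds for all `0 < δ ≤ 1`
    (AnalyticOnNhd ℝ F (Set.Ioc 1 x) →
      (∃ n₀ : ℕ, ∀ n : ℕ, n₀ ≤ n → 1 ≤ n →
        |(1 - 1 / x) ^ n * FSeq F (n - 1) (1 / x)| < (n.factorial : ℝ)) →
      ∀ δ xh : ℝ, 0 < δ → δ ≤ 1 → IsTranscSol x δ xh →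
        Summable (fun n : ℕ => seriesTerm F x δ (n + 1)) ∧
        F xh = F x - ∑' n : ℕ, seriesTerm F x δ (n + 1)) := by
  refine ⟨?_, exists_radius_hasSum_seriesTerm hx, ?_, ?_⟩
  · intro N xh hF hs
    refine ((isLittleO_transComp hx N hF).mono nhdsWithin_le_nhds).congr' ?_ EventuallyEq.rfl
    filter_upwards [hs] with δ h
    rw [transComp, h.symm_eq]
  · intro δ xh hδ hs hA hC s hT
    exact eq_sub_of_tendsto_seriesTerm hx hδ hs hA hC hT
  · intro hA hgrowth δ xh h0 h1 hs
    have hsum := summable_seriesTerm h0 h1 hgrowth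
    refine ⟨hsum, ?_⟩
    have hxh : 1 ≤ xh := one_le_of_isTranscSol hx h0 hs
    refine eq_sub_of_tendsto_seriesTerm hx h1 hs (hA.mono (Ioc_subset_Ioc_left hxh)) ?_ ?_
    -- Analyticity on `(1, x]` gives no continuity at `1`, but `xh = 1` forces `x = 1`, and the
    -- interval is a point.
    · rcases hxh.eq_or_lt with rfl | hlt
      · rw [eq_one_of_isTranscSol_one h0 hs, Icc_self]
        exact continuousOn_singleton F 1
      · exact hA.continuousOn.mono fun y hy => ⟨hlt.trans_le hy.1, hy.2⟩
    · refine hsum.hasSum.tendsto_sum_nat.congr fun N => ?_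
      rw [Finset.range_eq_Ico, Finset.sum_Ico_add' (fun n => seriesTerm F x δ n) 0 N 1]
      exact Finset.sum_congr (by ext; simp) fun _ _ => rfl
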